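/- **Setting.** Let $n\ge 0$, let $\nu=E^{\nu_0}NE^{\nu_1}\cdots NE^{\nu_n}$ be a northeast lattice path with $\nu_i\in\mathbb Z_{\ge 0}$, and let $\delta=(\delta_1,\dots,\delta_n)$ be integers with $0\le\delta_i\le\nu_i$. *Shape.* Put $\check\nu_0=\sum_{i=0}^n\nu_i-\sum_{i=1}^n\delta_i$. Let $\check\nu=E^{\check\nu_0}NE^{\delta_1}\cdots NE^{\delta_n}$, starting at $(0,0)$, and let $F_{\check\nu}$ be the region weakly above $\check\nu$ in its bounding rectangle. Let $\hat\nu=W^{\nu_0}NW^{\nu_1-\delta_1}\cdots NW^{\nu_n-\delta_n}$, starting at $(\check\nu_0,0)$. Let $F_{\delta,\nu}$ be the part of $F_{\check\nu}$ weakly above $\hat\nu$, and $L_{\delta,\nu}$ its set of lattice points. The nonempty columns of unit boxes of $F_{\delta,\nu}$ are top-aligned; from left to right let $u=u(\delta,\nu)$ be the (unimodal, positive) sequence of their numbers of boxes, so that the boxes of $F_{\delta,\nu}$ form the top-aligned shape $F_u$ whose $i$-th column has $u_i$ boxes. *Box complex.* Two distinct boxes $a,b$ of $F_u$ are incompatible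 if they lie in the same row or column, or if one is southwest of the other and the smallest rectangle containing both lies in $F_u$; otherwise they are compatible. The box complex $\Delta_u$ is the simplicial complex whose faces are the sets of pairwise compatible boxes of $F_u$ (including $\emptyset$). *Alt $\nu$-Tamari lattice.* Two points $p,q\in L_{\delta,\nu}$ are incompatible if one is strictly southwest of the other and the smallest rectangle containing both lies in $F_{\check\nu}$. A $(\delta,\nu)$-tree is a maximal set of pairwise compatible points of $L_{\delta,\nu}$. If $p,q,r\in T$ are the upper left, lower left and lower right corners of a rectangle (with sides of positive length) that contains no other point of the tree $T$, and $q'$ is its upper right corner, then $T'=(T\setminus\{q\})\cup\{q'\}$ is obtained from $T$ by a right rotation, provided it is a $(\delta,\nu)$-tree; $q'$ is then called a descent of $T'$. $\mathrm{Tam}_\nu(\delta)$ is the set of $(\delta,\nu)$-trees, ordered by $T\le T'$ if $T'$ arises from $T$ by a (possibly empty) sequence of right rotations. *Canonical join complex.* An element is join-irreducible if it covers exactly one element. A join representation of $a$ is a set of join-irreducible elements with least upper bound $a$. The canonical join representation of $a$ is the irredundant join representation $A$ of $a$ (no proper subset of $A$ has least upper bound $a$) that refines every join representation $B$ of $a$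 (each $x\in A$ satisfies $x\le y$ for some $y\in B$). The canonical join complex is the family, on the ground set of join-irreducible elements, of all canonical join representations of elements. **Theorem 1.1.** Every element of $\mathrm{Tam}_\nu(\delta)$ has exactly one canonical join representation; the canonical join complex of $\mathrm{Tam}_\nu(\delta)$ is closed under taking subsets, that is, it is a simplicial complex; and it is isomorphic to the box complex $\Delta_u$, $u=u(\delta,\nu)$. More precisely, there is a bijection $e$ from the boxes of $F_{\delta,\nu}$ to the join-irreducible elements of $\mathrm{Tam}_\nu(\delta)$ such that the tree $e(b)$ has exactly one descent, namely the upper right corner of the box $b$, and such that a set $\sigma$ of boxes is pairwise compatible if and only if $e(\sigma)$ is the canonical join representation of some element of $\mathrm{Tam}_\nu(\delta)$. -/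

import Mathlib

/-! ### Box complexes -/

/-- A family of subsets of a ground set `V` is a simplicial complex if it is closed under
inclusion.  The empty set is allowed as a face. -/
def IsSimplicialComplex {V : Type*} (Δ : Set (Set V)) : Prop :=
  ∀ σ ∈ Δ, ∀ τ ⊆ σ, τ ∈ Δ

/-- A bijection of ground sets that identifies the faces of `Δ` with the faces of `Γ`. -/
def IsComplexIso {V W : Type*} (Δ : Set (Set V)) (Γ : Set (Set W)) (e : V ≃ W) : Prop :=
  ∀ σ : Set V, σ ∈ Δ ↔ e '' σ ∈ Γ

/-- Unimodality `u₁ ≤ ⋯ ≤ u_k ≥ ⋯ ≥ u_m` of a finite sequence. -/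
def IsUnimodal {m : ℕ} (u : Fin m → ℕ) : Prop :=
  ∃ k : ℕ, ∀ i j : Fin m, i ≤ j →
    ((j : ℕ) ≤ k → u i ≤ u j) ∧ (k ≤ (i : ℕ) → u j ≤ u i)

/-- The boxes of the shape `F_u`.  The box `⟨i, r⟩` lies in column `i` (counted from the left,
starting with `0`) and in row `r` (counted from the common top line downwards, starting
with `0`); column `i` consists of `u i` boxes. -/
abbrev ShapeBox {m : ℕ} (u : Fin m → ℕ) : Type := Σ i : Fin m, Fin (u i)

/-- The box `a` is strictly southwest of the box `b`, and all the boxes of the smallest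
rectangle containing `a` and `b` belong to `F_u`. -/
def SouthwestWithin {m : ℕ} (u : Fin m → ℕ) (a b : ShapeBox u) : Prop :=
  a.1 < b.1 ∧ (b.2 : ℕ) < a.2 ∧
    ∀ i : Fin m, a.1 ≤ i → i ≤ b.1 → ∀ r : ℕ, (b.2 : ℕ) ≤ r → r ≤ a.2 → r < u i

/-- Incompatibility of boxes (used for distinct boxes only). -/
def BoxIncompatible {m : ℕ} (u : Fin m → ℕ) (a b : ShapeBox u) : Prop :=
  SouthwestWithin u a b ∨ SouthwestWithin u b a ∨ a.1 = b.1 ∨ (a.2 : ℕ) = b.2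

/-- The box complex `Δ_u`: its faces are the sets of pairwise compatible boxes of `F_u`. -/
def boxComplex {m : ℕ} (u : Fin m → ℕ) : Set (Set (ShapeBox u)) :=
  {σ | σ.Pairwise fun a b => ¬ BoxIncompatible u a b}

theorem boxComplex_isSimplicialComplex {m : ℕ} (u : Fin m → ℕ) :
    IsSimplicialComplex (boxComplex u) :=
  fun _ hσ _ hτ => Set.Pairwise.mono hτ hσ

/-! ### The canonical join complex -/

section Canonical

variable {P : Type*} [PartialOrder P]

/-- An element is join-irreducible if it covers exactly one element. -/
def JoinIrr (j : P) : Prop := ∃! c : P, c ⋖ j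

/-- A join representation of `a`: a set of join-irreducible elements with join `a`. -/
def IsJoinRep (A : Set P) (a : P) : Prop :=
  (∀ x ∈ A, JoinIrr x) ∧ IsLUB A a

/-- `A` refines `B` if every element of `A` lies below some element of `B`. -/
def JoinRefines (A B : Set P) : Prop := ∀ x ∈ A, ∃ y ∈ B, x ≤ y

/-- The canonical join representation of `a`: the irredundant join representation of `a` that
refines every join representation of `a`. -/
def IsCanonicalJoinRep (A : Set P) (a : P) : Prop :=
  IsJoinRep A a ∧ (∀ B ⊂ A, ¬ IsLUB B a) ∧ ∀ B : Set P, IsJoinRep B a → JoinRefines A B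

/-- The canonical join complex, on the ground set of the join-irreducible elements: its faces
are the canonical join representations of the elements of `P`. -/
def canonicalJoinComplex (P : Type*) [PartialOrder P] : Set (Set {j : P // JoinIrr j}) :=
  {A | ∃ a : P, IsCanonicalJoinRep (Subtype.val '' A) a}

end Canonical

/-! ### The shape of `(δ, ν)`

The path `ν = E^{ν₀} N E^{ν₁} ⋯ N E^{νₙ}` is encoded by `ν : Fin (n + 1) → ℕ`, the increment
vector `(δ₁, …, δₙ)` by `δ : Fin n → ℕ`, so that `δ i` belongs to `ν i.succ`. -/

section Shape

variable {n : ℕ}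

/-- The number `ν̌₀ = ∑ νᵢ - ∑ δᵢ` of initial east steps of the path
`ν̌ = E^{ν̌₀} N E^{δ₁} ⋯ N E^{δₙ}`, which starts at the origin. -/
def checkZero (ν : Fin (n + 1) → ℕ) (δ : Fin n → ℕ) : ℤ :=
  ∑ i, (ν i : ℤ) - ∑ i, (δ i : ℤ)

/-- The abscissa of the rightmost point of `ν̌` at height `y`. -/
def rightEnd (ν : Fin (n + 1) → ℕ) (δ : Fin n → ℕ) (y : ℤ) : ℤ :=
  checkZero ν δ +
    ∑ i ∈ Finset.univ.filter (fun i : Fin n => ((i : ℕ) : ℤ) + 1 ≤ y), (δ i : ℤ)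

/-- The abscissa of the leftmost point at height `y` of the path
`ν̂ = W^{ν₀} N W^{ν₁ - δ₁} ⋯ N W^{νₙ - δₙ}`, which starts at `(ν̌₀, 0)`. -/
def leftEnd (ν : Fin (n + 1) → ℕ) (δ : Fin n → ℕ) (y : ℤ) : ℤ :=
  checkZero ν δ - (ν 0 : ℤ) -
    ∑ i ∈ Finset.univ.filter (fun i : Fin n => ((i : ℕ) : ℤ) + 1 ≤ y), ((ν i.succ : ℤ) - (δ i : ℤ))

/-- The lattice points of the Ferrers diagram `F_ν̌`: those weakly above `ν̌` in its bounding
rectangle. -/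
def InFerrers (ν : Fin (n + 1) → ℕ) (δ : Fin n → ℕ) (p : ℤ × ℤ) : Prop :=
  0 ≤ p.2 ∧ p.2 ≤ n ∧ 0 ≤ p.1 ∧ p.1 ≤ rightEnd ν δ p.2

/-- The set `L_{δ,ν}` of the lattice points of `F_{δ,ν}`: those of `F_ν̌` weakly above `ν̂`. -/
def InShape (ν : Fin (n + 1) → ℕ) (δ : Fin n → ℕ) (p : ℤ × ℤ) : Prop :=
  InFerrers ν δ p ∧ leftEnd ν δ p.2 ≤ p.1

/-- The unit square with lower left corner `p` is a box of `F_{δ,ν}`. -/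
def IsUnitBox (ν : Fin (n + 1) → ℕ) (δ : Fin n → ℕ) (p : ℤ × ℤ) : Prop :=
  InShape ν δ p ∧ InShape ν δ (p.1 + 1, p.2) ∧ InShape ν δ (p.1, p.2 + 1) ∧
    InShape ν δ (p.1 + 1, p.2 + 1)

/-- The number of columns of `F_{δ,ν}` that contain boxes, namely `ν₀ + ⋯ + ν_{n-1}`, the number
of boxes in the top row. -/
def numColumns (ν : Fin (n + 1) → ℕ) : ℕ := ∑ i : Fin n, ν i.castSucc

/-- The abscissa of the left side of column `i` of `F_{δ,ν}`, where the columns that contain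
boxes are numbered from the left, starting with `0`. -/
def columnAbscissa (ν : Fin (n + 1) → ℕ) (δ : Fin n → ℕ) (i : ℕ) : ℤ :=
  leftEnd ν δ ((n : ℤ) - 1) + i

open Classical in
/-- The sequence `u = u(δ, ν)` of the column heights of `F_{δ,ν}`, for which `F_{δ,ν}` is the
shape `F_u`. -/
noncomputable def shapeSeq (ν : Fin (n + 1) → ℕ) (δ : Fin n → ℕ) (i : Fin (numColumns ν)) : ℕ :=
  ((Finset.range n).filter fun y : ℕ => IsUnitBox ν δ (columnAbscissa ν δ i, (y : ℤ))).card

/-- The upper right corner in `F_{δ,ν}` of a box of `F_u`, `u = u(δ, ν)`. -/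
def upperRight (ν : Fin (n + 1) → ℕ) (δ : Fin n → ℕ) (b : ShapeBox (shapeSeq ν δ)) : ℤ × ℤ :=
  (columnAbscissa ν δ b.1 + 1, (n : ℤ) - (b.2 : ℕ))

theorem leftEnd_anti {ν : Fin (n + 1) → ℕ} {δ : Fin n → ℕ} (hδ : ∀ i, δ i ≤ ν i.succ)
    {y z : ℤ} (h : y ≤ z) : leftEnd ν δ z ≤ leftEnd ν δ y := by
  unfold leftEnd
  refine sub_le_sub_left (Finset.sum_le_sum_of_subset_of_nonneg ?_ ?_) _
  · intro i hi
    simp only [Finset.mem_filter, Finset.mem_univ, true_and] at hi ⊢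
    omega
  · intro i _ _
    have := hδ i
    omega

theorem rightEnd_mono (ν : Fin (n + 1) → ℕ) (δ : Fin n → ℕ) {y z : ℤ} (h : y ≤ z) :
    rightEnd ν δ y ≤ rightEnd ν δ z := by
  unfold rightEnd
  refine add_le_add_right (Finset.sum_le_sum_of_subset_of_nonneg ?_ ?_) _
  · intro i hi
    simp only [Finset.mem_filter, Finset.mem_univ, true_and] at hi ⊢
    omega
  · intro i _ _
    omega

theorem leftEnd_top (ν : Fin (n + 1) → ℕ) (δ : Fin n → ℕ) : leftEnd ν δ n = 0 := by
  unfold leftEnd checkZero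
  rw [Finset.filter_true_of_mem (fun i _ => by have := i.2; omega), Fin.sum_univ_succ,
    Finset.sum_sub_distrib]
  ring

theorem rightEnd_sub_leftEnd (ν : Fin (n + 1) → ℕ) (δ : Fin n → ℕ) (hn : 0 < n) :
    rightEnd ν δ ((n : ℤ) - 1) - leftEnd ν δ ((n : ℤ) - 1) = numColumns ν := by
  obtain ⟨k, rfl⟩ : ∃ k, n = k + 1 := ⟨n - 1, by omega⟩
  unfold rightEnd leftEnd numColumns
  have h : (Finset.univ.filter fun i : Fin (k + 1) => ((i : ℕ) : ℤ) + 1 ≤ ((k + 1 : ℕ) : ℤ) - 1)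
      = Finset.univ.map Fin.castSuccEmb := by
    ext i
    simp only [Finset.mem_filter, Finset.mem_univ, true_and, Finset.mem_map]
    constructor
    · intro hi
      have hk : (i : ℕ) < k := by push_cast at hi; omega
      exact ⟨⟨i, hk⟩, rfl⟩
    · rintro ⟨j, rfl⟩
      have := j.2
      simp only [Fin.coe_castSuccEmb, Fin.val_castSucc]
      push_cast
      omega
  rw [h, Finset.sum_map, Finset.sum_map, Fin.sum_univ_succ (n := k)]
  push_cast
  rw [Finset.sum_sub_distrib]
  simp only [Fin.castSucc_zero, Fin.succ_castSucc]
  ring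

theorem isUnitBox_iff {ν : Fin (n + 1) → ℕ} {δ : Fin n → ℕ} (hδ : ∀ i, δ i ≤ ν i.succ)
    (x y : ℤ) : IsUnitBox ν δ (x, y) ↔
      0 ≤ y ∧ y < n ∧ leftEnd ν δ y ≤ x ∧ x < rightEnd ν δ y := by
  constructor
  · rintro ⟨⟨⟨h1, -⟩, h2⟩, ⟨⟨-, -, -, h3⟩, -⟩, ⟨⟨-, h4, -⟩, -⟩, -⟩
    simp only at *
    exact ⟨h1, by omega, h2, by omega⟩
  · rintro ⟨h1, h2, h3, h4⟩
    have a1 := leftEnd_anti hδ (show y ≤ y + 1 by omega)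
    have a2 := leftEnd_anti hδ (show y + 1 ≤ n by omega)
    have a3 := rightEnd_mono ν δ (show y ≤ y + 1 by omega)
    rw [leftEnd_top] at a2
    refine ⟨⟨⟨?_, ?_, ?_, ?_⟩, ?_⟩, ⟨⟨?_, ?_, ?_, ?_⟩, ?_⟩, ⟨⟨?_, ?_, ?_, ?_⟩, ?_⟩,
      ⟨⟨?_, ?_, ?_, ?_⟩, ?_⟩⟩ <;> simp only <;> omega

theorem mem_iff_of_upClosed {n : ℕ} {S : Finset ℕ} (hS : ∀ y ∈ S, y < n)
    (hup : ∀ y ∈ S, ∀ z, y ≤ z → z < n → z ∈ S) (y : ℕ) : y ∈ S ↔ n - S.card ≤ y ∧ y < n := by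
  rcases S.eq_empty_or_nonempty with rfl | hne
  · simp
  · have hEq : S = Finset.Ico (S.min' hne) n := by
      ext z
      rw [Finset.mem_Ico]
      exact ⟨fun hz => ⟨S.min'_le z hz, hS z hz⟩,
        fun hz => hup _ (S.min'_mem hne) z hz.1 hz.2⟩
    have hc : S.card = n - S.min' hne := by
      conv_lhs => rw [hEq]
      exact Nat.card_Ico _ _
    have hlt := hS _ (S.min'_mem hne)
    have hmem : y ∈ S ↔ S.min' hne ≤ y ∧ y < n := by
      conv_lhs => rw [hEq]
      exact Finset.mem_Ico
    rw [hmem]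
    omega

theorem isUnitBox_column_iff {ν : Fin (n + 1) → ℕ} {δ : Fin n → ℕ} (hδ : ∀ i, δ i ≤ ν i.succ)
    (i : Fin (numColumns ν)) (y : ℕ) :
    IsUnitBox ν δ (columnAbscissa ν δ i, (y : ℤ)) ↔ n - shapeSeq ν δ i ≤ y ∧ y < n := by
  classical
  have key := mem_iff_of_upClosed (n := n)
    (S := (Finset.range n).filter fun y : ℕ => IsUnitBox ν δ (columnAbscissa ν δ i, (y : ℤ)))
    (fun y hy => Finset.mem_range.1 (Finset.mem_filter.1 hy).1)
    (by
      intro y hy z hyz hz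
      rw [Finset.mem_filter, isUnitBox_iff hδ] at hy ⊢
      have a1 := leftEnd_anti hδ (show (y : ℤ) ≤ z by omega)
      have a2 := rightEnd_mono ν δ (show (y : ℤ) ≤ z by omega)
      refine ⟨Finset.mem_range.2 hz, by omega, by omega, by omega, by omega⟩) y
  have hcard : shapeSeq ν δ i = ((Finset.range n).filter fun y : ℕ =>
      IsUnitBox ν δ (columnAbscissa ν δ i, (y : ℤ))).card := by
    unfold shapeSeq
    congr
  rw [hcard, ← key, Finset.mem_filter, Finset.mem_range]
  refine ⟨fun h => ⟨?_, h⟩, fun h => h.2⟩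
  have := (isUnitBox_iff hδ _ _).1 h
  omega

theorem shapeSeq_le (ν : Fin (n + 1) → ℕ) (δ : Fin n → ℕ) (i : Fin (numColumns ν)) :
    shapeSeq ν δ i ≤ n := by
  classical
  unfold shapeSeq
  exact (Finset.card_filter_le _ _).trans (by simp)

theorem numColumns_pos {ν : Fin (n + 1) → ℕ} (h : 0 < numColumns ν) : 0 < n := by
  rcases Nat.eq_zero_or_pos n with rfl | hn
  · simp [numColumns] at h
  · exact hn

/-- The sequence `u(δ, ν)` consists of positive integers. -/
theorem shapeSeq_pos {ν : Fin (n + 1) → ℕ} {δ : Fin n → ℕ} (hδ : ∀ i, δ i ≤ ν i.succ)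
    (i : Fin (numColumns ν)) : 0 < shapeSeq ν δ i := by
  have hi := i.2
  have hn := numColumns_pos (ν := ν) (by omega)
  have hw := rightEnd_sub_leftEnd ν δ hn
  have h := (isUnitBox_column_iff hδ i (n - 1)).1 (by
    rw [isUnitBox_iff hδ]
    have : ((n - 1 : ℕ) : ℤ) = (n : ℤ) - 1 := by omega
    rw [this]
    unfold columnAbscissa
    refine ⟨by omega, by omega, by omega, by omega⟩)
  omega

/-- The sequence `u(δ, ν)` is unimodal. -/
theorem shapeSeq_isUnimodal {ν : Fin (n + 1) → ℕ} {δ : Fin n → ℕ} (hδ : ∀ i, δ i ≤ ν i.succ) :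
    IsUnimodal (shapeSeq ν δ) := by
  have hq : ∀ i l j : Fin (numColumns ν), i ≤ l → l ≤ j →
      min (shapeSeq ν δ i) (shapeSeq ν δ j) ≤ shapeSeq ν δ l := by
    intro i l j hil hlj
    have hil' : (i : ℕ) ≤ l := hil
    have hlj' : (l : ℕ) ≤ j := hlj
    have pi := shapeSeq_pos hδ i
    have pj := shapeSeq_pos hδ j
    have bi := shapeSeq_le ν δ i
    have bj := shapeSeq_le ν δ j
    obtain ⟨c, hc⟩ : ∃ c, c = min (shapeSeq ν δ i) (shapeSeq ν δ j) := ⟨_, rfl⟩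
    have h1 := (isUnitBox_column_iff hδ i (n - c)).2 ⟨by omega, by omega⟩
    have h2 := (isUnitBox_column_iff hδ j (n - c)).2 ⟨by omega, by omega⟩
    rw [isUnitBox_iff hδ] at h1 h2
    have h3 := (isUnitBox_column_iff hδ l (n - c)).1 (by
      rw [isUnitBox_iff hδ]
      unfold columnAbscissa at *
      refine ⟨by omega, by omega, by omega, by omega⟩)
    omega
  rcases Nat.eq_zero_or_pos (numColumns ν) with h0 | h0
  · exact ⟨0, fun i => absurd i.2 (by omega)⟩
  · have : Nonempty (Fin (numColumns ν)) := ⟨⟨0, h0⟩⟩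
    obtain ⟨k, hk⟩ := Finite.exists_max (shapeSeq ν δ)
    refine ⟨k, fun i j hij => ⟨fun hj => ?_, fun hi => ?_⟩⟩
    · have := hq i j k hij hj
      rwa [min_eq_left (hk i)] at this
    · have := hq k i j hi hij
      rwa [min_eq_right (hk j)] at this

/-- `F_{δ,ν}` is the shape `F_u` for `u = u(δ, ν)`: its boxes are those of `F_u`, moved so that
the leftmost column has abscissa `columnAbscissa ν δ 0` and the top line has ordinate `n`. -/
theorem isUnitBox_iff_exists_shapeBox {ν : Fin (n + 1) → ℕ} {δ : Fin n → ℕ}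
    (hδ : ∀ i, δ i ≤ ν i.succ) (p : ℤ × ℤ) :
    IsUnitBox ν δ p ↔
      ∃ b : ShapeBox (shapeSeq ν δ), upperRight ν δ b = (p.1 + 1, p.2 + 1) := by
  obtain ⟨x, y⟩ := p
  constructor
  · intro h
    obtain ⟨h1, h2, h3, h4⟩ := (isUnitBox_iff hδ x y).1 h
    have hw := rightEnd_sub_leftEnd ν δ (by omega)
    have a1 := leftEnd_anti hδ (show y ≤ (n : ℤ) - 1 by omega)
    have a2 := rightEnd_mono ν δ (show y ≤ (n : ℤ) - 1 by omega)
    obtain ⟨i, hi⟩ : ∃ i : Fin (numColumns ν), columnAbscissa ν δ i = x :=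
      ⟨⟨(x - leftEnd ν δ ((n : ℤ) - 1)).toNat, by omega⟩, by
        unfold columnAbscissa
        simp only
        omega⟩
    obtain ⟨t, rfl⟩ := Int.eq_ofNat_of_zero_le h1
    rw [← hi, isUnitBox_column_iff hδ] at h
    refine ⟨⟨i, ⟨n - 1 - t, by omega⟩⟩, ?_⟩
    simp only [upperRight, hi, Prod.mk.injEq, true_and]
    omega
  · rintro ⟨⟨i, r⟩, hb⟩
    have hr := r.2
    have hl := shapeSeq_le ν δ i
    simp only [upperRight, Prod.mk.injEq] at hb
    have hx : x = columnAbscissa ν δ i := by omega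
    have hy : y = ((n - 1 - r : ℕ) : ℤ) := by omega
    rw [hx, hy, isUnitBox_column_iff hδ]
    omega

/-! ### The alt `ν`-Tamari lattice -/

/-- `p` is strictly southwest of `q`, and the smallest rectangle containing `p` and `q` lies
in `F_ν̌`. -/
def NodeSouthwestWithin (ν : Fin (n + 1) → ℕ) (δ : Fin n → ℕ) (p q : ℤ × ℤ) : Prop :=
  p.1 < q.1 ∧ p.2 < q.2 ∧
    ∀ s : ℤ × ℤ, p.1 ≤ s.1 → s.1 ≤ q.1 → p.2 ≤ s.2 → s.2 ≤ q.2 → InFerrers ν δ s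

/-- `ν̌`-compatibility of lattice points. -/
def NodeCompatible (ν : Fin (n + 1) → ℕ) (δ : Fin n → ℕ) (p q : ℤ × ℤ) : Prop :=
  ¬ NodeSouthwestWithin ν δ p q ∧ ¬ NodeSouthwestWithin ν δ q p

/-- A `(δ,ν)`-tree: a maximal set of pairwise `ν̌`-compatible points of `L_{δ,ν}`. -/
def IsTree (ν : Fin (n + 1) → ℕ) (δ : Fin n → ℕ) (T : Finset (ℤ × ℤ)) : Prop :=
  Maximal (fun S : Finset (ℤ × ℤ) => (∀ p ∈ S, InShape ν δ p) ∧
    ∀ p ∈ S, ∀ q ∈ S, NodeCompatible ν δ p q) T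

/-- The underlying type of `Tam_ν(δ)`: the `(δ,ν)`-trees. -/
def AltTamari (ν : Fin (n + 1) → ℕ) (δ : Fin n → ℕ) : Type :=
  {T : Finset (ℤ × ℤ) // IsTree ν δ T}

/-- `T'` is obtained from `T` by the right rotation that exchanges `q ∈ T` with `q' ∈ T'`: here
`q` is the lower left and `q'` the upper right corner of the rectangle spanned by the nodes `p`
(upper left corner) and `r` (lower right corner) of `T`, and this rectangle contains no node
of `T` other than `p`, `q`, `r`. -/
def IsRightRotation (T T' : Finset (ℤ × ℤ)) (q q' : ℤ × ℤ) : Prop :=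
  q.1 < q'.1 ∧ q.2 < q'.2 ∧ q ∈ T ∧ (q.1, q'.2) ∈ T ∧ (q'.1, q.2) ∈ T ∧
    (∀ s ∈ T, q.1 ≤ s.1 → s.1 ≤ q'.1 → q.2 ≤ s.2 → s.2 ≤ q'.2 →
      s = q ∨ s = (q.1, q'.2) ∨ s = (q'.1, q.2)) ∧
    T' = insert q' (T.erase q)

/-- `T'` is obtained from `T` by a right rotation. -/
def RotatesTo {ν : Fin (n + 1) → ℕ} {δ : Fin n → ℕ} (T T' : AltTamari ν δ) : Prop :=
  ∃ q q' : ℤ × ℤ, IsRightRotation T.1 T'.1 q q'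

/-- The node `s` of `T` is a descent: a left rotation can be applied to it. -/
def IsDescent {ν : Fin (n + 1) → ℕ} {δ : Fin n → ℕ} (T : AltTamari ν δ) (s : ℤ × ℤ) : Prop :=
  ∃ (T₀ : AltTamari ν δ) (q : ℤ × ℤ), IsRightRotation T₀.1 T.1 q s

theorem RotatesTo.sum_lt {ν : Fin (n + 1) → ℕ} {δ : Fin n → ℕ} {T T' : AltTamari ν δ}
    (h : RotatesTo T T') : ∑ s ∈ T.1, s.2 < ∑ s ∈ T'.1, s.2 := by
  obtain ⟨q, q', h1, h2, hq, -, -, hbox, hT⟩ := h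
  have hq' : q' ∉ T.1 := by
    intro hm
    rcases hbox q' hm h1.le le_rfl h2.le le_rfl with h | h | h
    · rw [h] at h1
      exact lt_irrefl _ h1
    · have := congrArg Prod.fst h
      simp only at this
      omega
    · have := congrArg Prod.snd h
      simp only at this
      omega
  rw [hT, Finset.sum_insert (fun hm => hq' (Finset.mem_of_mem_erase hm)),
    ← Finset.add_sum_erase T.1 _ hq]
  omega

theorem RotatesTo.eq_or_sum_lt {ν : Fin (n + 1) → ℕ} {δ : Fin n → ℕ} {T T' : AltTamari ν δ}
    (h : Relation.ReflTransGen RotatesTo T T') :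
    T = T' ∨ ∑ s ∈ T.1, s.2 < ∑ s ∈ T'.1, s.2 := by
  induction h with
  | refl => exact Or.inl rfl
  | tail _ h2 ih =>
    have := h2.sum_lt
    rcases ih with rfl | ih
    · exact Or.inr this
    · exact Or.inr (ih.trans this)

/-- The rotation order: `T ≤ T'` if `T'` is obtained from `T` by a sequence of right
rotations. -/
instance AltTamari.instPartialOrder (ν : Fin (n + 1) → ℕ) (δ : Fin n → ℕ) :
    PartialOrder (AltTamari ν δ) where
  le T T' := Relation.ReflTransGen RotatesTo T T'
  le_refl _ := Relation.ReflTransGen.refl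
  le_trans _ _ _ h h' := h.trans h'
  le_antisymm T T' h h' := by
    rcases RotatesTo.eq_or_sum_lt h with h1 | h1
    · exact h1
    · rcases RotatesTo.eq_or_sum_lt h' with h2 | h2
      · exact h2.symm
      · omega

end Shape

/-!
A tree is determined by its height function `t`, where `t x` is the ordinate of the topmost node in
column `x`.  The height functions are characterized by the condition that `t x' ≤ t x` for all
columns `x' > x` which row `t x` reaches to the right, together with a lower bound given by the
shape (`IsHeight`).  They are closed under pointwise infima.  A point `(x, y)` of the shape is a node
of the tree if and only if `y ≤ t x` and `t x' ≤ y` for all columns `x' > x` which row `y` reaches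
(`IsHeightNode`), and any set of compatible points lies in such a set of nodes
(`AltTamari.exists_subset_nodeSet`), whence these are exactly the trees.

A right rotation raises `t` in the single column of the new node.  If `s < t` are height functions,
then in the last column `X` where they differ `t` can be lowered to a greatest value `z < t X` with
`s X ≤ z`, and this is the inverse of a right rotation (`exists_isLowering`,
`AltTamari.exists_rotatesTo`).  So the rotation order is the pointwise order of height functions
(`AltTamari.le_iff`), and it is a finite lattice.

A box with upper right corner `(X, Y)` gives the least height function `j` with `Y ≤ j X`.  Let `κ`
and `w` be the greatest height functions with values at most `Y - 1` in the columns from `X`,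
respectively `X + 1`, to the end of row `Y - 1`.  A height function `t ≤ w` satisfies either `j ≤ t`
or `t ≤ κ`.  Two boxes `a ≠ b` are compatible if and only if `j b ≤ κ a` and `j a ≤ κ b`, and every
`t` is the join of the compatible set of the `j` of the boxes `(X, z + 1)`, where `X` runs over the
columns that can be lowered, to `z`.  These facts (`KappaLabelling`) imply the statements about
canonical join representations: if `t` is the join of `j a` and of elements below `κ a`, then
`t ≤ w a`, and elements below `t` that are not above `j a` are all below `κ a`, so that a set of them
cannot have the join `t`.
-/

/-! ### Canonical join representations from a labelling by pairs -/

section CanonicalJoin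

variable {B P : Type*} [PartialOrder P]

theorem IsCanonicalJoinRep.eq_of_le {A : Set P} {a x y : P} (hA : IsCanonicalJoinRep A a)
    (hx : x ∈ A) (hy : y ∈ A) (hxy : x ≤ y) : x = y := by
  by_contra hne
  refine hA.2.1 (A \ {x}) (Set.sdiff_singleton_ssubset.2 hx) ⟨?_, ?_⟩
  · exact fun z hz => hA.1.2.1 hz.1
  · refine fun z hz => hA.1.2.2 fun v hv => ?_
    by_cases hvx : v = x
    · exact hvx ▸ hxy.trans (hz ⟨hy, fun h => hne h.symm⟩)
    · exact hz ⟨hv, hvx⟩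

theorem IsCanonicalJoinRep.subset {A A' : Set P} {a : P} (hA : IsCanonicalJoinRep A a)
    (hA' : IsCanonicalJoinRep A' a) : A ⊆ A' := by
  intro x hx
  obtain ⟨y, hy, hxy⟩ := hA.2.2 A' hA'.1 x hx
  obtain ⟨z, hz, hyz⟩ := hA'.2.2 A hA.1 y hy
  have hxz := hA.eq_of_le hx hz (hxy.trans hyz)
  have : x = y := le_antisymm hxy (hxz ▸ hyz)
  exact this ▸ hy

theorem IsCanonicalJoinRep.unique {A A' : Set P} {a : P} (hA : IsCanonicalJoinRep A a)
    (hA' : IsCanonicalJoinRep A' a) : A = A' :=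
  (hA.subset hA').antisymm (hA'.subset hA)

variable (B P) in
/-- A labelling of the join-irreducible elements of `P` by `B`.  To the label `b` belong the
join-irreducible element `j b`, an element `κ b` that is not above `j b`, and a bound `w b ≥ κ b`
such that every element below `w b` is either above `j b` or below `κ b`.  Every element is the
join of a set of `j b` each of which lies below the `κ a` of all the other labels `a`. -/
structure KappaLabelling where
  /-- The join-irreducible element with a given label. -/
  j : B → P
  /-- The element which `j b` has to be tested against. -/
  κ : B → P
  /-- The bound under which `j b` and `κ b` are complementary. -/
  w : B → P
  j_injective : Function.Injective j
  j_not_le_κ : ∀ b, ¬ j b ≤ κ b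
  j_le_w : ∀ b, j b ≤ w b
  κ_le_w : ∀ b, κ b ≤ w b
  le_κ : ∀ b t, t ≤ w b → ¬ j b ≤ t → t ≤ κ b
  exists_isLUB : ∀ S : Set P, ∃ t, IsLUB S t
  exists_rep : ∀ t, ∃ σ : Set B, IsLUB (j '' σ) t ∧ σ.Pairwise fun a b => j b ≤ κ a

namespace KappaLabelling

variable (K : KappaLabelling B P)

theorem le_κ_of_lt {b : B} {s : P} (h : s < K.j b) : s ≤ K.κ b :=
  K.le_κ b s (h.le.trans (K.j_le_w b)) h.not_ge

/-- The join of all elements strictly below `j b` is below `κ b`, so it is the only lower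
cover of `j b`. -/
theorem joinIrr_j (b : B) : JoinIrr (K.j b) := by
  obtain ⟨c, hc⟩ := K.exists_isLUB {s | s < K.j b}
  have hcκ : c ≤ K.κ b := hc.2 fun s hs => K.le_κ_of_lt hs
  have hcj : c < K.j b := lt_of_le_of_ne (hc.2 fun s hs => le_of_lt hs)
    fun h => K.j_not_le_κ b (h ▸ hcκ)
  refine ⟨c, ⟨hcj, fun s hcs hsj => (hc.1 hsj).not_gt hcs⟩, fun d hd => ?_⟩
  exact (hc.1 hd.1).eq_of_not_lt fun h => hd.2 h hcj

theorem exists_j_eq [Finite P] {t : P} (ht : JoinIrr t) : ∃ b, K.j b = t := by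
  obtain ⟨c, hc, huniq⟩ := ht
  obtain ⟨σ, hσ, -⟩ := K.exists_rep t
  by_contra! hne
  refine (hσ.2 ?_ : t ≤ c).not_gt hc.lt
  rintro _ ⟨b, hb, rfl⟩
  obtain ⟨d, hbd, hd⟩ := exists_le_covBy_of_lt (lt_of_le_of_ne (hσ.1 ⟨b, hb, rfl⟩) (hne b))
  exact huniq d hd ▸ hbd

theorem isCanonicalJoinRep {σ : Set B} (hσ : σ.Pairwise fun a b => K.j b ≤ K.κ a) {t : P}
    (ht : IsLUB (K.j '' σ) t) : IsCanonicalJoinRep (K.j '' σ) t := by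
  refine ⟨⟨?_, ht⟩, ?_, ?_⟩
  · rintro _ ⟨b, -, rfl⟩
    exact K.joinIrr_j b
  · rintro A ⟨hA, hA'⟩ hlub
    obtain ⟨_, ⟨a, ha, rfl⟩, haA⟩ := Set.not_subset.1 hA'
    refine K.j_not_le_κ a ((ht.1 ⟨a, ha, rfl⟩).trans (hlub.2 fun x hx => ?_))
    obtain ⟨b, hb, rfl⟩ := hA hx
    exact hσ ha hb fun h => haA (h ▸ hx)
  · rintro A ⟨-, hA⟩ _ ⟨a, ha, rfl⟩
    by_contra! hne
    have htw : t ≤ K.w a := by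
      refine ht.2 ?_
      rintro _ ⟨b, hb, rfl⟩
      by_cases hab : a = b
      · exact hab ▸ K.j_le_w a
      · exact (hσ ha hb hab).trans (K.κ_le_w a)
    exact K.j_not_le_κ a ((ht.1 ⟨a, ha, rfl⟩).trans
      (hA.2 fun x hx => K.le_κ a x ((hA.1 hx).trans htw) (hne x hx)))

theorem existsUnique_canonicalJoinRep (K : KappaLabelling B P) (t : P) :
    ∃! A : Set P, IsCanonicalJoinRep A t := by
  obtain ⟨σ, hσ, hc⟩ := K.exists_rep t
  exact ⟨_, K.isCanonicalJoinRep hc hσ, fun A hA => hA.unique (K.isCanonicalJoinRep hc hσ)⟩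

theorem exists_isCanonicalJoinRep_iff {σ : Set B} :
    (∃ t, IsCanonicalJoinRep (K.j '' σ) t) ↔ σ.Pairwise fun a b => K.j b ≤ K.κ a := by
  constructor
  · rintro ⟨t, ht⟩
    obtain ⟨τ, hτ, hc⟩ := K.exists_rep t
    have := (K.isCanonicalJoinRep hc hτ).unique ht
    rwa [← (K.j_injective.image_injective this)]
  · intro h
    obtain ⟨t, ht⟩ := K.exists_isLUB (K.j '' σ)
    exact ⟨t, K.isCanonicalJoinRep h ht⟩

/-- The labels are in bijection with the join-irreducible elements. -/
noncomputable def equiv [Finite P] : B ≃ {t : P // JoinIrr t} :=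
  Equiv.ofBijective (fun b => ⟨K.j b, K.joinIrr_j b⟩)
    ⟨fun _ _ h => K.j_injective (congrArg Subtype.val h), fun t =>
      (K.exists_j_eq t.2).imp fun _ h => Subtype.ext h⟩

@[simp] theorem coe_equiv [Finite P] (b : B) : (K.equiv b : P) = K.j b := rfl

theorem image_equiv_mem_canonicalJoinComplex_iff [Finite P] {σ : Set B} :
    K.equiv '' σ ∈ canonicalJoinComplex P ↔ σ.Pairwise fun a b => K.j b ≤ K.κ a := by
  rw [← K.exists_isCanonicalJoinRep_iff, canonicalJoinComplex, Set.mem_ofPred_eq, Set.image_image]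
  rfl

theorem isSimplicialComplex_canonicalJoinComplex [Finite P] (K : KappaLabelling B P) :
    IsSimplicialComplex (canonicalJoinComplex P) := by
  intro σ hσ τ hτ
  rw [← K.equiv.image_preimage τ, K.image_equiv_mem_canonicalJoinComplex_iff]
  rw [← K.equiv.image_preimage σ, K.image_equiv_mem_canonicalJoinComplex_iff] at hσ
  exact hσ.mono (Set.preimage_mono hτ)

end KappaLabelling

end CanonicalJoin

/-! ### Height functions -/

section Height

/-- The functions `t` that record the ordinate `t x` of the topmost node in each column `x` of a
tree in the shape with rows `[L y, R y]`, `0 ≤ y ≤ n`.  The value `n` is forced in the columns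
which do not meet the shape, and in those which no rotation can provide with a new node. -/
structure IsHeight (n : ℤ) (L R t : ℤ → ℤ) : Prop where
  nonneg : ∀ x, 0 ≤ t x
  le : ∀ x, t x ≤ n
  left_lt : ∀ x, t x < n → L (t x) < x
  le_right : ∀ x, t x < n → x ≤ R (t x)
  nest : ∀ x x', x < x' → x' ≤ R (t x) → t x' ≤ t x

/-- The point `(x, y)` is a node of the tree with height function `t`. -/
structure IsHeightNode (L R t : ℤ → ℤ) (x y : ℤ) : Prop where
  nonneg : 0 ≤ y
  left_le : L y ≤ x
  le_right : x ≤ R y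
  le : y ≤ t x
  right_le : ∀ x', x < x' → x' ≤ R y → t x' ≤ y

/-- The function with value `v` on `[u, R v]` and `n` elsewhere. -/
def plateau (n : ℤ) (R : ℤ → ℤ) (u v x : ℤ) : ℤ := if u ≤ x ∧ x ≤ R v then v else n

/-- The pointwise infimum of a set of height functions. -/
noncomputable def heightInf (U : Set (ℤ → ℤ)) (x : ℤ) : ℤ := sInf ((fun s => s x) '' U)

/-- The least height function with value at least `Y` in column `X`. -/
noncomputable def leastHeight (n : ℤ) (L R : ℤ → ℤ) (X Y : ℤ) : ℤ → ℤ :=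
  heightInf {s | IsHeight n L R s ∧ Y ≤ s X}

variable {n : ℤ} {L R s t : ℤ → ℤ}

theorem isHeight_plateau {u v : ℤ} (hv : 0 ≤ v) (hvn : v ≤ n)
    (hu : L v < u) : IsHeight n L R (plateau n R u v) := by
  refine ⟨fun x => ?_, fun x => ?_, fun x => ?_, fun x => ?_, fun x x' => ?_⟩ <;>
    unfold plateau <;> split_ifs <;> intros <;> omega

theorem le_plateau_iff (ht : ∀ x, t x ≤ n) {u v : ℤ} :
    t ≤ plateau n R u v ↔ ∀ x, u ≤ x → x ≤ R v → t x ≤ v := by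
  constructor
  · intro h x h1 h2
    have := h x
    rwa [plateau, if_pos ⟨h1, h2⟩] at this
  · intro h x
    unfold plateau
    split_ifs with hx
    · exact h x hx.1 hx.2
    · exact ht x

theorem isHeight_const (hn : 0 ≤ n) : IsHeight n L R fun _ => n :=
  ⟨fun _ => hn, fun _ => le_rfl, fun _ h => absurd h (lt_irrefl n),
    fun _ h => absurd h (lt_irrefl n), fun _ _ _ _ => le_rfl⟩

theorem heightInf_le {U : Set (ℤ → ℤ)} (hU : ∀ s ∈ U, IsHeight n L R s) (hs : s ∈ U) :
    heightInf U ≤ s := fun _ =>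
  csInf_le ⟨0, by rintro _ ⟨r, hr, rfl⟩; exact (hU r hr).nonneg _⟩ ⟨s, hs, rfl⟩

theorem exists_heightInf_eq {U : Set (ℤ → ℤ)} (hU : ∀ s ∈ U, IsHeight n L R s)
    (hne : U.Nonempty) (x : ℤ) : ∃ s ∈ U, s x = heightInf U x :=
  Int.csInf_mem (hne.image _) ⟨0, by rintro _ ⟨r, hr, rfl⟩; exact (hU r hr).nonneg _⟩

theorem isHeight_heightInf {U : Set (ℤ → ℤ)} (hU : ∀ s ∈ U, IsHeight n L R s)
    (hne : U.Nonempty) : IsHeight n L R (heightInf U) := by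
  have key := exists_heightInf_eq hU hne
  refine ⟨fun x => ?_, fun x => ?_, fun x => ?_, fun x => ?_, fun x x' => ?_⟩ <;>
    obtain ⟨s, hs, hx⟩ := key x <;> rw [← hx]
  · exact (hU s hs).nonneg x
  · exact (hU s hs).le x
  · exact (hU s hs).left_lt x
  · exact (hU s hs).le_right x
  · exact fun h h' => (heightInf_le hU hs x').trans ((hU s hs).nest x x' h h')

theorem le_heightInf {U : Set (ℤ → ℤ)} (hU : ∀ s ∈ U, IsHeight n L R s)
    (hne : U.Nonempty) (h : ∀ s ∈ U, t ≤ s) : t ≤ heightInf U := by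
  intro x
  obtain ⟨s, hs, hx⟩ := exists_heightInf_eq hU hne x
  exact hx ▸ h s hs x

theorem isHeight_leastHeight {X Y : ℤ} (hn : 0 ≤ n) (hY : Y ≤ n) :
    IsHeight n L R (leastHeight n L R X Y) :=
  isHeight_heightInf (fun _ h => h.1) ⟨fun _ => n, isHeight_const hn, hY⟩

theorem le_leastHeight {X Y : ℤ} (hn : 0 ≤ n) (hY : Y ≤ n) : Y ≤ leastHeight n L R X Y X := by
  obtain ⟨s, hs, hx⟩ := exists_heightInf_eq (U := {s | IsHeight n L R s ∧ Y ≤ s X})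
    (fun _ h => h.1) ⟨fun _ => n, isHeight_const hn, hY⟩ X
  exact hs.2.trans_eq hx

theorem leastHeight_le_iff {X Y : ℤ} (hY : Y ≤ n) (ht : IsHeight n L R t) :
    leastHeight n L R X Y ≤ t ↔ Y ≤ t X :=
  ⟨fun h => (le_leastHeight ((ht.nonneg X).trans (ht.le X)) hY).trans (h X),
    fun h => heightInf_le (U := {s | IsHeight n L R s ∧ Y ≤ s X}) (fun _ h => h.1) ⟨ht, h⟩⟩

theorem leastHeight_self (hL : Antitone L) (hR : Monotone R) {X Y : ℤ} (hY : 0 < Y) (hYn : Y ≤ n)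
    (h1 : L (Y - 1) < X) (h2 : X ≤ R (Y - 1)) : leastHeight n L R X Y X = Y := by
  have a1 := hL (show Y - 1 ≤ Y by omega)
  have a2 := hR (show Y - 1 ≤ Y by omega)
  have hX : plateau n R X Y X = Y := if_pos ⟨le_rfl, by omega⟩
  have h := (leastHeight_le_iff (X := X) hYn
    (isHeight_plateau hY.le hYn (show L Y < X by omega))).2 hX.ge X
  exact le_antisymm (h.trans_eq hX) (le_leastHeight (by omega) hYn)

theorem isHeightNode_top (ht : IsHeight n L R t) (hL : ∀ x, 0 ≤ x → L n ≤ x) {x : ℤ} (h0 : 0 ≤ x)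
    (hx : x ≤ R n) : IsHeightNode L R t x (t x) := by
  have h1 := ht.left_lt x
  have h2 := ht.le_right x
  have h3 := ht.le x
  have h4 := hL x h0
  rcases h3.lt_or_eq with h | h
  · exact ⟨ht.nonneg x, (h1 h).le, h2 h, le_rfl, ht.nest x⟩
  · exact ⟨ht.nonneg x, by rwa [h], by rwa [h], le_rfl, ht.nest x⟩

/-- In the column at the left end of row `y` the topmost node lies above row `y`: a topmost node
below row `n` is never leftmost in its row. -/
theorem IsHeight.lt_apply_left (ht : IsHeight n L R t) (hL : Antitone L) {y : ℤ} (hy : y < n) :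
    y < t (L y) := by
  by_contra! h
  have h1 := ht.left_lt (L y) (by omega)
  have h2 := hL h
  omega

theorem exists_last_lt {p : ℤ → Prop} {a X : ℤ} (ha : a < X) (hp : p a) :
    ∃ x < X, p x ∧ ∀ x', x < x' → x' < X → ¬ p x' := by
  obtain ⟨x, hx, hmax⟩ := Int.exists_greatest_of_bdd (P := fun x => x < X ∧ p x)
    ⟨X, fun z hz => hz.1.le⟩ ⟨a, ha, hp⟩
  exact ⟨x, hx.1, hx.2, fun x' h1 h2 h3 => absurd (hmax x' ⟨h2, h3⟩) (by omega)⟩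

/-- A row that ends below the top in some column `X` of the shape continues to the left. -/
theorem exists_isHeightNode_left (ht : IsHeight n L R t) (hL : Antitone L)
    {X : ℤ} (hX : t X < n) : ∃ x < X, IsHeightNode L R t x (t X) := by
  have h1 := ht.left_lt X hX
  have h2 := ht.le_right X hX
  have hbig := ht.lt_apply_left hL hX
  obtain ⟨x, hxX, hx, hmax⟩ := exists_last_lt (p := fun x => t X < t x) h1 hbig
  refine ⟨x, hxX, ht.nonneg X, ?_, by omega, le_of_lt hx, fun x' h3 h4 => ?_⟩
  · by_contra! h
    exact hmax _ h h1 hbig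
  · rcases lt_trichotomy x' X with h | h | h
    · exact not_lt.1 (hmax x' h3 h)
    · rw [h]
    · exact ht.nest X x' h h4

theorem IsHeight.eq_of_isHeightNode_imp (hs : IsHeight n L R s) (ht : IsHeight n L R t)
    (hL : Antitone L) (hR : Monotone R) (hL0 : L n = 0)
    (h : ∀ x y, IsHeightNode L R s x y → IsHeightNode L R t x y) : s = t := by
  have hn : 0 ≤ n := (hs.nonneg 0).trans (hs.le 0)
  funext x
  refine le_antisymm ?_ (not_lt.1 fun hlt => ?_)
  · rcases (ht.le x).lt_or_eq with hx | hx
    · have h1 := hL hx.le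
      have h2 := hR hx.le
      have h3 := ht.left_lt x hx
      have h4 := ht.le_right x hx
      exact (h x _ (isHeightNode_top hs (by omega) (by omega) (by omega))).le
    · exact (hs.le x).trans hx.ge
  · have hx : s x < n := hlt.trans_le (ht.le x)
    obtain ⟨x', hx', hnode⟩ := exists_isHeightNode_left hs hL hx
    exact (hlt.trans_le ((h _ _ hnode).right_le x hx' (hs.le_right x hx))).false

/-- `X` is a column of the height function `t` that can be lowered to `z`, and `z` is the greatest
such value below `t X`. -/
structure IsLowering (L R t : ℤ → ℤ) (X z : ℤ) : Prop where
  nonneg : 0 ≤ z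
  lt : z < t X
  left_lt : L z < X
  le_right : X ≤ R z
  right_le : ∀ x, X < x → x ≤ R z → t x ≤ z
  maximal : ∀ y, z < y → y < t X → ∃ x, X < x ∧ x ≤ R y ∧ y < t x

/-- The column is the last one in which `s` and `t` differ. -/
theorem exists_isLowering (hs : IsHeight n L R s) (ht : IsHeight n L R t) (hL : Antitone L)
    (hR : Monotone R) (hst : s ≤ t) (hne : s ≠ t) :
    ∃ X z, IsLowering L R t X z ∧ s X ≤ z := by
  obtain ⟨a, ha⟩ : ∃ a, s a < t a := by
    by_contra! h
    exact hne (le_antisymm hst h)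
  obtain ⟨X, hX, hXmax⟩ := Int.exists_greatest_of_bdd (P := fun x => s x < t x)
    ⟨R n, fun x hx => by
      have h1 := ht.le x
      have h2 := hs.le_right x (by omega)
      have h3 := hR (hs.le x)
      omega⟩ ⟨a, ha⟩
  have h1 := ht.le X
  have h2 := hs.le_right X (by omega)
  have h3 := hs.left_lt X (by omega)
  obtain ⟨z, hz, hall, hzmax⟩ := exists_last_lt
    (p := fun z => s X ≤ z ∧ ∀ x, X < x → x ≤ R z → t x ≤ z) hX ⟨le_rfl, fun x h4 h5 => by
      have h6 : ¬ s x < t x := fun h => absurd (hXmax x h) (by omega)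
      have h7 := hs.nest X x h4 h5
      omega⟩
  have h4 := hR hall.1
  have h5 := hL hall.1
  have h6 := hs.nonneg X
  refine ⟨X, z, ⟨by omega, hz, by omega, by omega, hall.2, fun y hy hyt => ?_⟩, hall.1⟩
  have := hzmax y hy hyt
  push Not at this
  exact this (by omega)

variable {X z : ℤ}

theorem IsLowering.isHeight (h : IsLowering L R t X z) (ht : IsHeight n L R t) :
    IsHeight n L R (Function.update t X z) := by
  have h1 := h.nonneg
  have h2 := h.lt
  have h3 := ht.le X
  refine ⟨fun x => ?_, fun x => ?_, fun x => ?_, fun x => ?_, fun x x' hx hx' => ?_⟩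
  · by_cases e : x = X
    · subst e; simpa using h1
    · simpa [e] using ht.nonneg x
  · by_cases e : x = X
    · subst e; simp; omega
    · simpa [e] using ht.le x
  · by_cases e : x = X
    · subst e; simpa using fun _ => h.left_lt
    · simpa [e] using ht.left_lt x
  · by_cases e : x = X
    · subst e; simpa using fun _ => h.le_right
    · simpa [e] using ht.le_right x
  · by_cases e : x = X
    · subst e
      rw [Function.update_self] at hx' ⊢
      rw [Function.update_of_ne (by omega)]
      exact h.right_le x' hx hx'
    · rw [Function.update_of_ne e] at hx' ⊢
      have h4 := ht.nest x x' hx hx'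
      by_cases e' : x' = X
      · subst e'; rw [Function.update_self]; omega
      · rwa [Function.update_of_ne e']

/-- A column before `X` whose topmost node is lower than that of `X` has it at or below row `z`:
otherwise column `X` could be lowered to this height. -/
theorem IsLowering.le_of_lt (h : IsLowering L R t X z) (ht : IsHeight n L R t) {x : ℤ}
    (hx : x < X) (hlt : t x < t X) : t x ≤ z := by
  by_contra! hz
  obtain ⟨x', h1, h2, h3⟩ := h.maximal (t x) hz hlt
  exact h3.not_ge (ht.nest x x' (by omega) h2)

theorem IsLowering.lt_of_lt (h : IsLowering L R t X z) (ht : IsHeight n L R t)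
    {x : ℤ} (hx : x < X) (hlt : t x < t X) : t x < z := by
  refine lt_of_le_of_ne (h.le_of_lt ht hx hlt) fun e => ?_
  exact hlt.not_ge (ht.nest x X hx (e ▸ h.le_right))

/-- The lower left corner of the rectangle of the rotation at `X` lies in the last column before
`X` with topmost node at least as high as in `X`. -/
theorem IsLowering.exists_corner (h : IsLowering L R t X z) (ht : IsHeight n L R t)
    (hL : Antitone L) :
    ∃ a < X, L z ≤ a ∧ t X ≤ t a ∧ ∀ x, a < x → x < X → t x < z := by
  have h1 := h.lt
  have h2 := ht.le X
  have hbig := ht.lt_apply_left hL (show z < n by omega)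
  have hbig' : t X ≤ t (L z) := by
    by_contra! hc
    have := h.le_of_lt ht h.left_lt hc
    omega
  obtain ⟨a, haX, ha, hmax⟩ := exists_last_lt (p := fun x => t X ≤ t x) h.left_lt hbig'
  refine ⟨a, haX, ?_, ha, fun x h3 h4 => h.lt_of_lt ht h4 (not_le.1 (hmax x h3 h4))⟩
  by_contra! hc
  exact hmax _ hc h.left_lt hbig'

/-- Lowering column `X` exchanges the node `(X, t X)` for the node `(a, z)`. -/
theorem IsLowering.isHeightNode_iff (h : IsLowering L R t X z) {a : ℤ} (haX : a < X)
    (hLa : L z ≤ a) (ha : t X ≤ t a)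
    (hgap : ∀ x, a < x → x < X → t x < z) (x y : ℤ) :
    IsHeightNode L R (Function.update t X z) x y ↔
      (IsHeightNode L R t x y ∧ (x, y) ≠ (X, t X)) ∨ (x, y) = (a, z) := by
  have h1 := h.lt
  have h0 := h.le_right
  constructor
  · intro hN
    obtain ⟨n1, n2, n3, n4, n5⟩ := hN
    rcases lt_trichotomy x X with hx | hx | hx
    · rw [Function.update_of_ne hx.ne] at n4
      by_cases hv : X ≤ R y ∧ y < t X
      · right
        have hzy : z ≤ y := by simpa using n5 X hx hv.1
        have hyz : y = z := by
          by_contra hne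
          obtain ⟨x', h2, h3, h4⟩ := h.maximal y (by omega) hv.2
          have := n5 x' (by omega) h3
          rw [Function.update_of_ne (by omega)] at this
          omega
        subst hyz
        have : x = a := by
          rcases lt_trichotomy x a with h2 | h2 | h2
          · have := n5 a h2 (by omega)
            rw [Function.update_of_ne (by omega)] at this
            omega
          · exact h2
          · have := hgap x h2 hx
            omega
        rw [this]
      · left
        refine ⟨⟨n1, n2, n3, n4, fun x' h2 h3 => ?_⟩, fun e => hx.ne (congrArg Prod.fst e)⟩
        by_cases e : x' = X
        · subst e; omega
        · have := n5 x' h2 h3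
          rwa [Function.update_of_ne e] at this
    · subst hx
      rw [Function.update_self] at n4
      refine Or.inl ⟨⟨n1, n2, n3, by omega, fun x' h2 h3 => ?_⟩, fun e => ?_⟩
      · have := n5 x' h2 h3
        rwa [Function.update_of_ne (by omega)] at this
      · have := congrArg Prod.snd e
        simp only at this
        omega
    · rw [Function.update_of_ne (by omega)] at n4
      refine Or.inl ⟨⟨n1, n2, n3, by omega, fun x' h2 h3 => ?_⟩,
        fun e => hx.ne' (congrArg Prod.fst e)⟩
      have := n5 x' h2 h3
      rwa [Function.update_of_ne (by omega)] at this
  · rintro (⟨⟨n1, n2, n3, n4, n5⟩, hne⟩ | e)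
    · refine ⟨n1, n2, n3, ?_, fun x' h2 h3 => ?_⟩
      · by_cases e : x = X
        · subst e
          rw [Function.update_self]
          by_contra! hzy
          have hyt : y ≠ t x := fun e => hne (by rw [e])
          obtain ⟨x', h2, h3, h4⟩ := h.maximal y hzy (by omega)
          have := n5 x' h2 h3
          omega
        · rwa [Function.update_of_ne e]
      · have := n5 x' h2 h3
        by_cases e : x' = X
        · subst e; rw [Function.update_self]; omega
        · rwa [Function.update_of_ne e]
    · simp only [Prod.mk.injEq] at e
      obtain ⟨rfl, rfl⟩ := e
      refine ⟨h.nonneg, hLa, by omega, ?_, fun x' h2 h3 => ?_⟩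
      · rw [Function.update_of_ne (by omega)]
        omega
      · rcases lt_trichotomy x' X with e | e | e
        · rw [Function.update_of_ne (by omega)]
          exact (hgap x' h2 e).le
        · rw [e, Function.update_self]
        · rw [Function.update_of_ne (by omega)]
          exact h.right_le x' e h3

end Height

/-! ### Trees and their height functions -/

namespace AltTamari

variable {n : ℕ} {ν : Fin (n + 1) → ℕ} {δ : Fin n → ℕ} {s t : ℤ → ℤ}

theorem antitone_leftEnd (hδ : ∀ i, δ i ≤ ν i.succ) : Antitone (leftEnd ν δ) :=
  fun _ _ h => leftEnd_anti hδ h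

theorem monotone_rightEnd : Monotone (rightEnd ν δ) := fun _ _ h => rightEnd_mono ν δ h

open Classical in
variable (ν δ) in
/-- The set of the nodes of the tree with height function `t`. -/
noncomputable def nodeSet (t : ℤ → ℤ) : Finset (ℤ × ℤ) :=
  (Finset.Icc 0 (rightEnd ν δ n) ×ˢ Finset.Icc (0 : ℤ) n).filter fun p =>
    IsHeightNode (leftEnd ν δ) (rightEnd ν δ) t p.1 p.2

theorem _root_.IsHeightNode.inShape (hδ : ∀ i, δ i ≤ ν i.succ)
    (ht : IsHeight n (leftEnd ν δ) (rightEnd ν δ) t)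
    {x y : ℤ} (h : IsHeightNode (leftEnd ν δ) (rightEnd ν δ) t x y) : InShape ν δ (x, y) := by
  have h1 := h.le.trans (ht.le x)
  have h2 := antitone_leftEnd hδ h1
  rw [leftEnd_top] at h2
  exact ⟨⟨h.nonneg, h1, h2.trans h.left_le, h.le_right⟩, h.left_le⟩

theorem mem_nodeSet (hδ : ∀ i, δ i ≤ ν i.succ) (ht : IsHeight n (leftEnd ν δ) (rightEnd ν δ) t)
    (p : ℤ × ℤ) : p ∈ nodeSet ν δ t ↔ IsHeightNode (leftEnd ν δ) (rightEnd ν δ) t p.1 p.2 := by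
  simp only [nodeSet, Finset.mem_filter, Finset.mem_product, Finset.mem_Icc, and_iff_right_iff_imp]
  intro h
  obtain ⟨⟨h1, h2, h3, h4⟩, -⟩ := h.inShape hδ ht
  exact ⟨⟨h3, h4.trans (rightEnd_mono ν δ h2)⟩, h1, h2⟩

theorem eq_of_nodeSet_subset (hδ : ∀ i, δ i ≤ ν i.succ)
    (hs : IsHeight n (leftEnd ν δ) (rightEnd ν δ) s)
    (ht : IsHeight n (leftEnd ν δ) (rightEnd ν δ) t) (h : nodeSet ν δ s ⊆ nodeSet ν δ t) :
    s = t :=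
  hs.eq_of_isHeightNode_imp ht (antitone_leftEnd hδ) monotone_rightEnd (leftEnd_top ν δ)
    fun x y hN => (mem_nodeSet hδ ht (x, y)).1 (h ((mem_nodeSet hδ hs (x, y)).2 hN))

/-- The rectangle spanned by two points of the shape lies in the Ferrers diagram as soon as its
lower right corner does. -/
theorem nodeSouthwestWithin_iff {p q : ℤ × ℤ} (hp : InShape ν δ p) (hq : InShape ν δ q) :
    NodeSouthwestWithin ν δ p q ↔ p.1 < q.1 ∧ p.2 < q.2 ∧ q.1 ≤ rightEnd ν δ p.2 := by
  constructor
  · rintro ⟨h1, h2, h3⟩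
    exact ⟨h1, h2, (h3 (q.1, p.2) h1.le le_rfl le_rfl h2.le).2.2.2⟩
  · rintro ⟨h1, h2, h3⟩
    refine ⟨h1, h2, fun s hs1 hs2 hs3 hs4 => ?_⟩
    obtain ⟨⟨a1, -, a3, -⟩, -⟩ := hp
    obtain ⟨⟨-, b2, -, -⟩, -⟩ := hq
    have := rightEnd_mono ν δ hs3
    exact ⟨by omega, by omega, by omega, by omega⟩

theorem nodeCompatible_of_mem_nodeSet (hδ : ∀ i, δ i ≤ ν i.succ)
    (ht : IsHeight n (leftEnd ν δ) (rightEnd ν δ) t) {p q : ℤ × ℤ} (hp : p ∈ nodeSet ν δ t)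
    (hq : q ∈ nodeSet ν δ t) : NodeCompatible ν δ p q := by
  have key : ∀ {p q : ℤ × ℤ}, p ∈ nodeSet ν δ t → q ∈ nodeSet ν δ t →
      ¬ NodeSouthwestWithin ν δ p q := by
    intro p q hp hq h
    rw [mem_nodeSet hδ ht] at hp hq
    rw [nodeSouthwestWithin_iff (hp.inShape hδ ht) (hq.inShape hδ ht)] at h
    exact h.2.1.not_ge (hq.le.trans (hp.right_le q.1 h.1 h.2.2))
  exact ⟨key hp hq, key hq hp⟩

/-- A compatible set of points consists of nodes of the tree whose height function is the infimum
of the greatest height functions that allow the single points. -/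
theorem exists_subset_nodeSet (hδ : ∀ i, δ i ≤ ν i.succ) {S : Finset (ℤ × ℤ)}
    (hS : ∀ p ∈ S, InShape ν δ p) (hc : ∀ p ∈ S, ∀ q ∈ S, NodeCompatible ν δ p q) :
    ∃ t, IsHeight n (leftEnd ν δ) (rightEnd ν δ) t ∧ S ⊆ nodeSet ν δ t := by
  set U : Set (ℤ → ℤ) := insert (fun _ => (n : ℤ))
    ((fun p : ℤ × ℤ => plateau n (rightEnd ν δ) (p.1 + 1) p.2) '' S) with hUdef
  have hU : ∀ s ∈ U, IsHeight n (leftEnd ν δ) (rightEnd ν δ) s := by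
    rintro _ (rfl | ⟨p, hp, rfl⟩)
    · exact isHeight_const (by omega)
    · obtain ⟨⟨h1, h2, -⟩, h3⟩ := hS p hp
      exact isHeight_plateau h1 h2 (by omega)
  have hne : U.Nonempty := ⟨_, Or.inl rfl⟩
  have ht := isHeight_heightInf hU hne
  refine ⟨heightInf U, ht, fun p hp => (mem_nodeSet hδ ht p).2 ?_⟩
  obtain ⟨⟨h1, h2, h3, h4⟩, h5⟩ := hS p hp
  refine ⟨h1, h5, h4, ?_, fun x hx hx' => ?_⟩
  · obtain ⟨_, rfl | ⟨q, hq, rfl⟩, he⟩ := exists_heightInf_eq hU hne p.1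
    · exact h2.trans_eq he
    · rw [← he]
      simp only [plateau]
      split_ifs with h
      · by_contra! hlt
        exact (hc p hp q hq).2
          ((nodeSouthwestWithin_iff (hS q hq) (hS p hp)).2 ⟨by omega, hlt, h.2⟩)
      · exact h2
  · exact (le_plateau_iff ht.le).1 (heightInf_le hU (Or.inr ⟨p, hp, rfl⟩)) x (by omega) hx'

theorem isTree_nodeSet (hδ : ∀ i, δ i ≤ ν i.succ)
    (ht : IsHeight n (leftEnd ν δ) (rightEnd ν δ) t) : IsTree ν δ (nodeSet ν δ t) := by
  refine ⟨⟨fun p hp => ((mem_nodeSet hδ ht p).1 hp).inShape hδ ht,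
    fun p hp q hq => nodeCompatible_of_mem_nodeSet hδ ht hp hq⟩, fun S hS hle => ?_⟩
  obtain ⟨s, hs, hSs⟩ := exists_subset_nodeSet hδ hS.1 hS.2
  exact eq_of_nodeSet_subset hδ ht hs (hle.trans hSs) ▸ hSs

/-- The tree with a given height function. -/
noncomputable def ofHeight (hδ : ∀ i, δ i ≤ ν i.succ) (t : ℤ → ℤ)
    (ht : IsHeight n (leftEnd ν δ) (rightEnd ν δ) t) : AltTamari ν δ :=
  ⟨nodeSet ν δ t, isTree_nodeSet hδ ht⟩

theorem exists_height (hδ : ∀ i, δ i ≤ ν i.succ) (T : AltTamari ν δ) :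
    ∃ t, IsHeight n (leftEnd ν δ) (rightEnd ν δ) t ∧ T.1 = nodeSet ν δ t := by
  obtain ⟨t, ht, hT⟩ := exists_subset_nodeSet hδ T.2.1.1 T.2.1.2
  exact ⟨t, ht, hT.antisymm (T.2.2 (isTree_nodeSet hδ ht).1 hT)⟩

/-- The height function of a tree. -/
noncomputable def height (hδ : ∀ i, δ i ≤ ν i.succ) (T : AltTamari ν δ) : ℤ → ℤ :=
  (exists_height hδ T).choose

theorem isHeight_height (hδ : ∀ i, δ i ≤ ν i.succ) (T : AltTamari ν δ) :
    IsHeight n (leftEnd ν δ) (rightEnd ν δ) (height hδ T) :=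
  (exists_height hδ T).choose_spec.1

theorem nodeSet_height (hδ : ∀ i, δ i ≤ ν i.succ) (T : AltTamari ν δ) :
    nodeSet ν δ (height hδ T) = T.1 :=
  (exists_height hδ T).choose_spec.2.symm

@[simp] theorem height_ofHeight (hδ : ∀ i, δ i ≤ ν i.succ)
    (ht : IsHeight n (leftEnd ν δ) (rightEnd ν δ) t) : height hδ (ofHeight hδ t ht) = t :=
  eq_of_nodeSet_subset hδ (isHeight_height hδ _) ht (nodeSet_height hδ (ofHeight hδ t ht)).subset

theorem height_injective (hδ : ∀ i, δ i ≤ ν i.succ) :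
    Function.Injective (height (ν := ν) (δ := δ) hδ) := fun T T' h =>
  Subtype.ext (by rw [← nodeSet_height hδ T, ← nodeSet_height hδ T', h])

theorem mem_iff (hδ : ∀ i, δ i ≤ ν i.succ) (T : AltTamari ν δ) (p : ℤ × ℤ) :
    p ∈ T.1 ↔ IsHeightNode (leftEnd ν δ) (rightEnd ν δ) (height hδ T) p.1 p.2 := by
  rw [← mem_nodeSet hδ (isHeight_height hδ T), nodeSet_height]

/-! ### The rotation order is the pointwise order of height functions -/

theorem top_mem (hδ : ∀ i, δ i ≤ ν i.succ) (T : AltTamari ν δ) {x : ℤ} (h0 : 0 ≤ x)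
    (hx : x ≤ rightEnd ν δ n) : (x, height hδ T x) ∈ T.1 :=
  (mem_iff hδ T _).2 (isHeightNode_top (isHeight_height hδ T)
    (fun _ hx => (leftEnd_top ν δ).trans_le hx) h0 hx)

/-- Outside of the columns of the shape a height function has the value `n`. -/
theorem height_eq_of_not (hδ : ∀ i, δ i ≤ ν i.succ) (T : AltTamari ν δ) {x : ℤ}
    (h : ¬ (0 ≤ x ∧ x ≤ rightEnd ν δ n)) : height hδ T x = n := by
  have ht := isHeight_height hδ T
  by_contra hne
  have h1 := ht.le x
  have h2 := ht.left_lt x (by omega)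
  have h3 := ht.le_right x (by omega)
  have h4 := leftEnd_anti hδ h1
  have h5 := rightEnd_mono ν δ h1
  rw [leftEnd_top] at h4
  omega

/-- A right rotation preserves the topmost nodes of all columns, except that the new node may be
above the topmost node of its column. -/
theorem height_le_of_isRightRotation (hδ : ∀ i, δ i ≤ ν i.succ) {T T' : AltTamari ν δ}
    {q q' : ℤ × ℤ} (h : IsRightRotation T.1 T'.1 q q') : height hδ T ≤ height hδ T' := by
  obtain ⟨-, h2, hq, hp, -, -, hT⟩ := h
  intro x
  by_cases hx : 0 ≤ x ∧ x ≤ rightEnd ν δ n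
  · have hmem := top_mem hδ T hx.1 hx.2
    have hne : (x, height hδ T x) ≠ q := by
      rintro rfl
      have := ((mem_iff hδ T _).1 hp).le
      simp only at this h2
      omega
    refine ((mem_iff hδ T' _).1 (?_ : (x, height hδ T x) ∈ T'.1)).le
    rw [hT]
    exact Finset.mem_insert_of_mem (Finset.mem_erase.2 ⟨hne, hmem⟩)
  · rw [height_eq_of_not hδ T hx, height_eq_of_not hδ T' hx]

theorem height_mono (hδ : ∀ i, δ i ≤ ν i.succ) {T T' : AltTamari ν δ} (h : T ≤ T') :
    height hδ T ≤ height hδ T' := by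
  change Relation.ReflTransGen RotatesTo T T' at h
  induction h with
  | refl => exact le_rfl
  | tail _ h ih =>
    obtain ⟨q, q', hq⟩ := h
    exact ih.trans (height_le_of_isRightRotation hδ hq)

/-- Where a right rotation raises the topmost node of a column, it is the new node. -/
theorem eq_of_isRightRotation (hδ : ∀ i, δ i ≤ ν i.succ) {T T' : AltTamari ν δ}
    {q q' : ℤ × ℤ} (h : IsRightRotation T.1 T'.1 q q') {x : ℤ}
    (hx : height hδ T x < height hδ T' x) : q' = (x, height hδ T' x) := by
  have hin : 0 ≤ x ∧ x ≤ rightEnd ν δ n := by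
    by_contra hx'
    rw [height_eq_of_not hδ T hx', height_eq_of_not hδ T' hx'] at hx
    exact hx.false
  have hmem := top_mem hδ T' hin.1 hin.2
  obtain ⟨-, -, -, -, -, -, hT⟩ := h
  rw [hT, Finset.mem_insert] at hmem
  rcases hmem with hmem | hmem
  · exact hmem.symm
  · exact absurd ((mem_iff hδ T _).1 (Finset.mem_of_mem_erase hmem)).le hx.not_ge

theorem exists_rotatesTo (hδ : ∀ i, δ i ≤ ν i.succ) (T : AltTamari ν δ) {X z : ℤ}
    (h : IsLowering (leftEnd ν δ) (rightEnd ν δ) (height hδ T) X z) :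
    ∃ T₀ : AltTamari ν δ, height hδ T₀ = Function.update (height hδ T) X z ∧ RotatesTo T₀ T := by
  have ht := isHeight_height hδ T
  have hL := antitone_leftEnd hδ
  obtain ⟨a, haX, hLa, ha, hgap⟩ := h.exists_corner ht hL
  have hiff := h.isHeightNode_iff haX hLa ha hgap
  set t := height hδ T with htdef
  set T₀ := ofHeight hδ _ (h.isHeight ht) with hT₀
  have hh : height hδ T₀ = Function.update t X z := height_ofHeight hδ _
  have hmem : ∀ p, p ∈ T₀.1 ↔ (p ∈ T.1 ∧ p ≠ (X, t X)) ∨ p = (a, z) := by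
    intro p
    rw [mem_iff hδ, mem_iff hδ, hh]
    exact hiff p.1 p.2
  have hz := h.lt
  have htX := ht.le X
  have haR : X ≤ rightEnd ν δ (t X) := h.le_right.trans (monotone_rightEnd hz.le)
  have hLz := hL hz.le
  have htop : (X, t X) ∈ T.1 := (mem_iff hδ T _).2
    ⟨ht.nonneg X, by simp only; omega, haR, le_rfl, ht.nest X⟩
  have hat : (a, z) ∉ T.1 := fun hm => by
    have : t X ≤ z := ((mem_iff hδ T _).1 hm).right_le X haX h.le_right
    omega
  refine ⟨T₀, hh, (a, z), (X, t X), haX, hz, (hmem _).2 (Or.inr rfl), (hmem _).2 (Or.inl ⟨?_, ?_⟩),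
    (hmem _).2 (Or.inl ⟨?_, ?_⟩), ?_, ?_⟩
  · refine (mem_iff hδ T _).2 ⟨ht.nonneg X, by simp only; omega, by simp only; omega, ha,
      fun x hx hx' => ?_⟩
    rcases lt_trichotomy x X with e | e | e
    · exact (hgap x hx e).le.trans hz.le
    · exact (congrArg t e).le
    · exact ht.nest X x e hx'
  · exact fun e => haX.ne (congrArg Prod.fst e)
  · exact (mem_iff hδ T _).2 ⟨h.nonneg, h.left_lt.le, h.le_right, hz.le, h.right_le⟩
  · exact fun e => hz.ne (congrArg Prod.snd e)
  · rintro ⟨x, y⟩ hm h1 h2 h3 h4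
    simp only at h1 h2 h3 h4
    rcases (hmem _).1 hm with ⟨hm, hne⟩ | e
    swap
    · exact Or.inl e
    have hN := (mem_iff hδ T _).1 hm
    have hyn : X ≤ rightEnd ν δ y := h.le_right.trans (rightEnd_mono ν δ h3)
    -- The three cases are the columns between `a` and `X`, column `X` and column `a`.
    rcases h1.lt_or_eq with h1 | rfl
    · rcases h2.lt_or_eq with h2 | rfl
      · have : y ≤ t x := hN.le
        have := hgap x h1 h2
        omega
      · have hyt : y < t x := lt_of_le_of_ne h4 fun e => hne (by rw [e])
        rcases h3.lt_or_eq with h3 | rfl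
        · obtain ⟨x', e1, e2, e3⟩ := h.maximal y h3 hyt
          exact absurd (hN.right_le x' e1 e2) e3.not_ge
        · exact Or.inr (Or.inr rfl)
    · have := hN.right_le X haX hyn
      have hy : y = t X := le_antisymm h4 this
      exact Or.inr (Or.inl (by rw [hy]))
  · ext p
    rw [Finset.mem_insert, Finset.mem_erase, hmem]
    constructor
    · intro hp
      by_cases e : p = (X, t X)
      · exact Or.inl e
      · exact Or.inr ⟨fun e' => hat (e' ▸ hp), Or.inl ⟨hp, e⟩⟩
    · rintro (rfl | ⟨hne, ⟨hp, -⟩ | rfl⟩)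
      · exact htop
      · exact hp
      · exact absurd rfl hne

theorem le_iff (hδ : ∀ i, δ i ≤ ν i.succ) {T T' : AltTamari ν δ} :
    T ≤ T' ↔ height hδ T ≤ height hδ T' := by
  refine ⟨height_mono hδ, ?_⟩
  -- Lowering columns of `T'` decreases the nonnegative sum of the ordinates of its nodes.
  induction hm : (∑ s ∈ T'.1, s.2).toNat using Nat.strong_induction_on generalizing T' with
  | _ m ih =>
    intro h
    by_cases he : height hδ T = height hδ T'
    · exact (height_injective hδ he).le
    obtain ⟨X, z, hlow, hz⟩ := exists_isLowering (isHeight_height hδ T) (isHeight_height hδ T')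
      (antitone_leftEnd hδ) monotone_rightEnd h he
    obtain ⟨T₀, hT₀, hrot⟩ := exists_rotatesTo hδ T' hlow
    have hlt := hrot.sum_lt
    have h0 : 0 ≤ ∑ s ∈ T₀.1, s.2 :=
      Finset.sum_nonneg fun s hs => ((mem_iff hδ T₀ s).1 hs).nonneg
    refine Relation.ReflTransGen.tail (ih _ (by omega) rfl ?_) hrot
    rw [hT₀]
    intro x
    by_cases e : x = X
    · subst e; simpa using hz
    · simpa [e] using h x

theorem ofHeight_le_iff (hδ : ∀ i, δ i ≤ ν i.succ)
    (ht : IsHeight n (leftEnd ν δ) (rightEnd ν δ) t) {T : AltTamari ν δ} :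
    ofHeight hδ t ht ≤ T ↔ t ≤ height hδ T := by
  rw [le_iff hδ, height_ofHeight]

theorem le_ofHeight_iff (hδ : ∀ i, δ i ≤ ν i.succ)
    (ht : IsHeight n (leftEnd ν δ) (rightEnd ν δ) t) {T : AltTamari ν δ} :
    T ≤ ofHeight hδ t ht ↔ height hδ T ≤ t := by
  rw [le_iff hδ, height_ofHeight]

theorem finite (ν : Fin (n + 1) → ℕ) (δ : Fin n → ℕ) : Finite (AltTamari ν δ) := by
  refine Finite.of_injective (β := (Finset.Icc 0 (rightEnd ν δ n) ×ˢ Finset.Icc (0 : ℤ) n).powerset)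
    (fun T => ⟨T.1, Finset.mem_powerset.2 fun p hp => ?_⟩)
    fun T T' h => Subtype.ext (Subtype.mk.inj h)
  obtain ⟨⟨h1, h2, h3, h4⟩, -⟩ := T.2.1.1 p hp
  exact Finset.mem_product.2 ⟨Finset.mem_Icc.2 ⟨h3, h4.trans (rightEnd_mono ν δ h2)⟩,
    Finset.mem_Icc.2 ⟨h1, h2⟩⟩

theorem exists_isLUB (hδ : ∀ i, δ i ≤ ν i.succ) (S : Set (AltTamari ν δ)) : ∃ T, IsLUB S T := by
  have hU : ∀ s ∈ height hδ '' upperBounds S, IsHeight n (leftEnd ν δ) (rightEnd ν δ) s := by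
    rintro _ ⟨T, -, rfl⟩
    exact isHeight_height hδ T
  have hne : (height hδ '' upperBounds S).Nonempty := by
    refine ⟨_, ofHeight hδ (fun _ => n) (isHeight_const (by omega)), fun T _ => ?_, rfl⟩
    exact (le_ofHeight_iff hδ _).2 (isHeight_height hδ T).le
  refine ⟨ofHeight hδ _ (isHeight_heightInf hU hne), fun T hT => ?_, fun T hT => ?_⟩
  · refine (le_ofHeight_iff hδ _).2 (le_heightInf hU hne ?_)
    rintro _ ⟨T', hT', rfl⟩
    exact (le_iff hδ).1 (hT' hT)
  · exact (ofHeight_le_iff hδ _).2 (heightInf_le hU ⟨T, hT, rfl⟩)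

/-! ### The labelling of the join-irreducible trees by boxes -/

theorem lt_shapeSeq_iff (hδ : ∀ i, δ i ≤ ν i.succ) (i : Fin (numColumns ν)) {r : ℕ} (hr : r < n) :
    r < shapeSeq ν δ i ↔ leftEnd ν δ ((n : ℤ) - r - 1) < columnAbscissa ν δ i + 1 ∧
      columnAbscissa ν δ i + 1 ≤ rightEnd ν δ ((n : ℤ) - r - 1) := by
  have h1 := isUnitBox_column_iff hδ i (n - 1 - r)
  rw [isUnitBox_iff hδ] at h1
  have h2 : ((n - 1 - r : ℕ) : ℤ) = (n : ℤ) - r - 1 := by omega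
  rw [h2] at h1
  have h3 := shapeSeq_le ν δ i
  constructor
  · intro h
    have := h1.2 ⟨by omega, by omega⟩
    omega
  · intro h
    have := h1.1 ⟨by omega, by omega, by omega, by omega⟩
    omega

theorem upperRight_spec (hδ : ∀ i, δ i ≤ ν i.succ) (b : ShapeBox (shapeSeq ν δ)) :
    0 < (upperRight ν δ b).2 ∧ (upperRight ν δ b).2 ≤ n ∧
      leftEnd ν δ ((upperRight ν δ b).2 - 1) < (upperRight ν δ b).1 ∧
      (upperRight ν δ b).1 ≤ rightEnd ν δ ((upperRight ν δ b).2 - 1) := by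
  have h1 := b.2.2
  have h2 := shapeSeq_le ν δ b.1
  have h3 := (lt_shapeSeq_iff hδ b.1 (show (b.2 : ℕ) < n by omega)).1 h1
  simp only [upperRight]
  refine ⟨by omega, by omega, h3.1, h3.2⟩

theorem exists_upperRight_eq (hδ : ∀ i, δ i ≤ ν i.succ) {X Y : ℤ} (hY : 0 < Y) (hYn : Y ≤ n)
    (h1 : leftEnd ν δ (Y - 1) < X) (h2 : X ≤ rightEnd ν δ (Y - 1)) :
    ∃ b, upperRight ν δ b = (X, Y) := by
  have := (isUnitBox_iff_exists_shapeBox hδ (X - 1, Y - 1)).1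
    ((isUnitBox_iff hδ _ _).2 ⟨by omega, by omega, by omega, by omega⟩)
  simpa using this

theorem upperRight_injective : Function.Injective (upperRight ν δ) := by
  rintro ⟨i, r⟩ ⟨i', r'⟩ h
  simp only [upperRight, columnAbscissa, Prod.mk.injEq] at h
  obtain rfl : i = i' := Fin.ext (by omega)
  obtain rfl : r = r' := Fin.ext (by omega)
  rfl

/-- The condition for two boxes to be incompatible in terms of their upper right corners.  The
shape being the union of the rows `[leftEnd y, rightEnd y]`, a box of column `X` reaches column
`X'` to the right in its own row if and only if `X' ≤ rightEnd (Y - 1)`. -/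
theorem boxIncompatible_iff (hδ : ∀ i, δ i ≤ ν i.succ) {a b : ShapeBox (shapeSeq ν δ)} :
    BoxIncompatible (shapeSeq ν δ) a b ↔
      (((upperRight ν δ a).1 ≤ (upperRight ν δ b).1 ∧
        (upperRight ν δ b).1 ≤ rightEnd ν δ ((upperRight ν δ a).2 - 1) ∧
        (upperRight ν δ a).2 ≤ (upperRight ν δ b).2) ∨
      ((upperRight ν δ b).1 ≤ (upperRight ν δ a).1 ∧
        (upperRight ν δ a).1 ≤ rightEnd ν δ ((upperRight ν δ b).2 - 1) ∧
        (upperRight ν δ b).2 ≤ (upperRight ν δ a).2)) := by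
  have hsw : ∀ {a b : ShapeBox (shapeSeq ν δ)}, SouthwestWithin (shapeSeq ν δ) a b ↔
      (upperRight ν δ a).1 < (upperRight ν δ b).1 ∧
        (upperRight ν δ b).1 ≤ rightEnd ν δ ((upperRight ν δ a).2 - 1) ∧
        (upperRight ν δ a).2 < (upperRight ν δ b).2 := by
    intro a b
    have ha := upperRight_spec hδ a
    have hb := upperRight_spec hδ b
    constructor
    · rintro ⟨h1, h2, h3⟩
      have h4 := h3 b.1 h1.le le_rfl a.2 h2.le le_rfl
      rw [lt_shapeSeq_iff hδ _ (by have := shapeSeq_le ν δ b.1; omega)] at h4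
      have h1' : (a.1 : ℕ) < b.1 := h1
      refine ⟨?_, h4.2, ?_⟩ <;> simp only [upperRight, columnAbscissa] <;> omega
    · rintro ⟨h1, h2, h3⟩
      simp only [upperRight, columnAbscissa] at h1 h2 h3 ha hb
      refine ⟨show (a.1 : ℕ) < b.1 by omega, by omega, fun i hai hib r hbr hra => ?_⟩
      have hai' : (a.1 : ℕ) ≤ i := hai
      have hib' : (i : ℕ) ≤ b.1 := hib
      have e1 := leftEnd_anti hδ (show (n : ℤ) - a.2 - 1 ≤ (n : ℤ) - r - 1 by omega)
      have e2 := rightEnd_mono ν δ (show (n : ℤ) - a.2 - 1 ≤ (n : ℤ) - r - 1 by omega)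
      rw [lt_shapeSeq_iff hδ _ (by omega), columnAbscissa]
      omega
  have ha := upperRight_spec hδ a
  have hb := upperRight_spec hδ b
  have hcol : a.1 = b.1 ↔ (upperRight ν δ a).1 = (upperRight ν δ b).1 := by
    rw [Fin.ext_iff]
    simp only [upperRight, columnAbscissa]
    omega
  have hrow : (a.2 : ℕ) = b.2 ↔ (upperRight ν δ a).2 = (upperRight ν δ b).2 := by
    simp only [upperRight]
    omega
  unfold BoxIncompatible
  rw [hsw, hsw, hcol, hrow]
  generalize upperRight ν δ a = p at *
  generalize upperRight ν δ b = q at *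
  rcases lt_trichotomy p.2 q.2 with h | h | h
  · have := rightEnd_mono ν δ (show p.2 - 1 ≤ q.2 - 1 by omega)
    omega
  · rw [h] at ha ⊢
    omega
  · have := rightEnd_mono ν δ (show q.2 - 1 ≤ p.2 - 1 by omega)
    omega

/-- The tree of the least height function with value at least `Y` in column `X`, where `(X, Y)` is
the upper right corner of the box. -/
noncomputable def boxJoin (hδ : ∀ i, δ i ≤ ν i.succ) (b : ShapeBox (shapeSeq ν δ)) :
    AltTamari ν δ :=
  ofHeight hδ (leastHeight n (leftEnd ν δ) (rightEnd ν δ) (upperRight ν δ b).1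
    (upperRight ν δ b).2) (isHeight_leastHeight (by omega) (upperRight_spec hδ b).2.1)

/-- The tree of the greatest height function with values below `Y` in the columns from `u` to the
end of row `Y - 1`, where `Y` is the ordinate of the upper right corner of the box. -/
noncomputable def boxPlateau (hδ : ∀ i, δ i ≤ ν i.succ) (b : ShapeBox (shapeSeq ν δ)) {u : ℤ}
    (hu : (upperRight ν δ b).1 ≤ u) : AltTamari ν δ :=
  ofHeight hδ (plateau n (rightEnd ν δ) u ((upperRight ν δ b).2 - 1)) (by
    have := upperRight_spec hδ b
    exact isHeight_plateau (by omega) (by omega) (by omega))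

theorem boxJoin_le_iff (hδ : ∀ i, δ i ≤ ν i.succ) {b : ShapeBox (shapeSeq ν δ)}
    {T : AltTamari ν δ} :
    boxJoin hδ b ≤ T ↔ (upperRight ν δ b).2 ≤ height hδ T (upperRight ν δ b).1 :=
  (ofHeight_le_iff hδ _).trans
    (leastHeight_le_iff (upperRight_spec hδ b).2.1 (isHeight_height hδ T))

theorem le_boxPlateau_iff (hδ : ∀ i, δ i ≤ ν i.succ) {b : ShapeBox (shapeSeq ν δ)} {u : ℤ}
    (hu : (upperRight ν δ b).1 ≤ u) {T : AltTamari ν δ} :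
    T ≤ boxPlateau hδ b hu ↔ ∀ x, u ≤ x →
      x ≤ rightEnd ν δ ((upperRight ν δ b).2 - 1) → height hδ T x ≤ (upperRight ν δ b).2 - 1 :=
  (le_ofHeight_iff hδ _).trans (le_plateau_iff (isHeight_height hδ T).le)

theorem boxJoin_le_boxPlateau_iff (hδ : ∀ i, δ i ≤ ν i.succ) {a b : ShapeBox (shapeSeq ν δ)}
    {u : ℤ} (hu : (upperRight ν δ a).1 ≤ u) :
    boxJoin hδ b ≤ boxPlateau hδ a hu ↔ ¬ (u ≤ (upperRight ν δ b).1 ∧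
      (upperRight ν δ b).1 ≤ rightEnd ν δ ((upperRight ν δ a).2 - 1) ∧
      (upperRight ν δ a).2 ≤ (upperRight ν δ b).2) := by
  have hb := upperRight_spec hδ b
  rw [boxJoin_le_iff, boxPlateau, height_ofHeight, plateau]
  split_ifs <;> omega

/-- A tree is the join of the trees `boxJoin b`, where `b` runs over the boxes `(X, z + 1)` given by
the columns `X` that can be lowered, to `z`, and these boxes are compatible. -/
theorem exists_isLUB_boxJoin (hδ : ∀ i, δ i ≤ ν i.succ) (T : AltTamari ν δ) :
    ∃ σ : Set (ShapeBox (shapeSeq ν δ)), IsLUB (boxJoin hδ '' σ) T ∧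
      σ.Pairwise fun a b => boxJoin hδ b ≤ boxPlateau hδ a le_rfl := by
  refine ⟨{b | IsLowering (leftEnd ν δ) (rightEnd ν δ) (height hδ T) (upperRight ν δ b).1
    ((upperRight ν δ b).2 - 1)}, ⟨?_, fun S hS => ?_⟩, fun a ha b hb hab => ?_⟩
  · rintro _ ⟨b, hb, rfl⟩
    have := IsLowering.lt hb
    exact (boxJoin_le_iff hδ).2 (by omega)
  · have hU : ∀ s ∈ ({height hδ S, height hδ T} : Set (ℤ → ℤ)),
        IsHeight n (leftEnd ν δ) (rightEnd ν δ) s := by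
      rintro _ (rfl | rfl)
      exacts [isHeight_height hδ S, isHeight_height hδ T]
    by_contra hTS
    obtain ⟨X, z, hlow, hz⟩ := exists_isLowering (isHeight_heightInf hU ⟨_, Or.inl rfl⟩)
      (isHeight_height hδ T) (antitone_leftEnd hδ) monotone_rightEnd (heightInf_le hU (Or.inr rfl))
      fun e => hTS ((le_iff hδ).2 (e ▸ heightInf_le hU (Or.inl rfl)))
    have h1 := (isHeight_height hδ T).le X
    have h2 := hlow.nonneg
    have h3 := hlow.lt
    have hz1 : z + 1 - 1 = z := by omega
    obtain ⟨b, hb⟩ := exists_upperRight_eq hδ (X := X) (Y := z + 1) (by omega) (by omega)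
      (by rw [hz1]; exact hlow.left_lt) (by rw [hz1]; exact hlow.le_right)
    have hbS := (boxJoin_le_iff hδ).1 (hS ⟨b, by
      simp only [Set.mem_ofPred_eq, hb, hz1]
      exact hlow, rfl⟩)
    simp only [hb] at hbS
    obtain ⟨_, rfl | rfl, he⟩ := exists_heightInf_eq hU ⟨_, Or.inl rfl⟩ X <;> omega
  · refine (boxJoin_le_boxPlateau_iff hδ _).2 ?_
    rintro ⟨h1, h2, h3⟩
    have hbt := IsLowering.lt hb
    rcases h1.lt_or_eq with h1 | h1
    · have := IsLowering.right_le ha _ h1 h2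
      omega
    · have hne : (upperRight ν δ a).2 ≠ (upperRight ν δ b).2 := fun e =>
        hab (upperRight_injective (Prod.ext h1 e))
      obtain ⟨x, e1, e2, e3⟩ := IsLowering.maximal ha ((upperRight ν δ b).2 - 1) (by omega)
        (by rw [h1]; exact hbt)
      exact e3.not_ge (IsLowering.right_le hb x (h1 ▸ e1) e2)

/-- The labelling of the join-irreducible trees by the boxes. -/
noncomputable def kappaLabelling (hδ : ∀ i, δ i ≤ ν i.succ) :
    KappaLabelling (ShapeBox (shapeSeq ν δ)) (AltTamari ν δ) where
  j := boxJoin hδ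
  κ b := boxPlateau hδ b le_rfl
  w b := boxPlateau hδ b (le_add_of_nonneg_right zero_le_one)
  j_injective a b h := by
    have key : ∀ {a b : ShapeBox (shapeSeq ν δ)}, boxJoin hδ a = boxJoin hδ b →
        (upperRight ν δ a).1 ≤ (upperRight ν δ b).1 ∧
          (upperRight ν δ a).2 ≤ (upperRight ν δ b).2 := by
      intro a b h
      by_contra hn
      have ha := upperRight_spec hδ a
      refine (boxJoin_le_boxPlateau_iff hδ (a := a) (b := a) le_rfl).1 ?_
        ⟨le_rfl, ha.2.2.2, le_rfl⟩
      rw [h]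
      exact (boxJoin_le_boxPlateau_iff hδ le_rfl).2 fun e => hn ⟨e.1, e.2.2⟩
    exact upperRight_injective (Prod.ext ((key h).1.antisymm (key h.symm).1)
      ((key h).2.antisymm (key h.symm).2))
  j_not_le_κ b h := (boxJoin_le_boxPlateau_iff hδ le_rfl).1 h
    ⟨le_rfl, (upperRight_spec hδ b).2.2.2, le_rfl⟩
  j_le_w b := (boxJoin_le_boxPlateau_iff hδ _).2 fun h => by omega
  κ_le_w b := (le_boxPlateau_iff hδ _).2 fun x h1 h2 =>
    (le_boxPlateau_iff hδ le_rfl).1 le_rfl x (by omega) h2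
  le_κ b T hw hj := by
    rw [le_boxPlateau_iff] at hw ⊢
    rw [boxJoin_le_iff] at hj
    intro x h1 h2
    rcases h1.lt_or_eq with h1 | rfl
    · exact hw x (by omega) h2
    · omega
  exists_isLUB := exists_isLUB hδ
  exists_rep := exists_isLUB_boxJoin hδ

theorem mem_boxComplex_iff (hδ : ∀ i, δ i ≤ ν i.succ) {σ : Set (ShapeBox (shapeSeq ν δ))} :
    σ ∈ boxComplex (shapeSeq ν δ) ↔
      σ.Pairwise fun a b => boxJoin hδ b ≤ boxPlateau hδ a le_rfl := by
  have key : ∀ a b : ShapeBox (shapeSeq ν δ), ¬ BoxIncompatible (shapeSeq ν δ) a b ↔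
      boxJoin hδ b ≤ boxPlateau hδ a le_rfl ∧ boxJoin hδ a ≤ boxPlateau hδ b le_rfl := by
    intro a b
    rw [boxJoin_le_boxPlateau_iff, boxJoin_le_boxPlateau_iff, ← not_or, boxIncompatible_iff hδ]
  exact ⟨fun h a ha b hb hab => ((key a b).1 (h ha hb hab)).1,
    fun h a ha b hb hab => (key a b).2 ⟨h ha hb hab, h hb ha hab.symm⟩⟩

theorem isDescent_boxJoin_iff (hδ : ∀ i, δ i ≤ ν i.succ) (b : ShapeBox (shapeSeq ν δ))
    (s : ℤ × ℤ) : IsDescent (boxJoin hδ b) s ↔ s = upperRight ν δ b := by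
  have hself : height hδ (boxJoin hδ b) (upperRight ν δ b).1 = (upperRight ν δ b).2 := by
    obtain ⟨h1, h2, h3, h4⟩ := upperRight_spec hδ b
    rw [boxJoin, height_ofHeight]
    exact leastHeight_self (antitone_leftEnd hδ) monotone_rightEnd h1 h2 h3 h4
  have key : ∀ {T₀ : AltTamari ν δ} {q s : ℤ × ℤ}, IsRightRotation T₀.1 (boxJoin hδ b).1 q s →
      s = upperRight ν δ b := by
    intro T₀ q s h
    have hrot : RotatesTo T₀ (boxJoin hδ b) := ⟨q, s, h⟩
    have hlt : height hδ T₀ (upperRight ν δ b).1 <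
        height hδ (boxJoin hδ b) (upperRight ν δ b).1 := by
      by_contra! hle
      have hle' : boxJoin hδ b ≤ T₀ := (boxJoin_le_iff hδ).2 (hself ▸ hle)
      have hle'' : T₀ ≤ boxJoin hδ b := Relation.ReflTransGen.single hrot
      exact hrot.sum_lt.ne (by rw [le_antisymm hle'' hle'])
    rw [eq_of_isRightRotation hδ h hlt, hself]
  constructor
  · rintro ⟨T₀, q, h⟩
    exact key h
  · rintro rfl
    -- The last step of a chain of rotations up from a lower cover produces a descent.
    obtain ⟨c, hc, -⟩ := (kappaLabelling hδ).joinIrr_j b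
    have hle : Relation.ReflTransGen RotatesTo c (boxJoin hδ b) := hc.1.le
    obtain he | ⟨T₀, -, q, s, h⟩ := Relation.ReflTransGen.cases_tail hle
    · exact absurd he hc.1.ne'
    · exact key h ▸ ⟨T₀, q, h⟩

end AltTamari

theorem theorem1p1 (n : ℕ) (ν : Fin (n + 1) → ℕ) (δ : Fin n → ℕ)
    (hδ : ∀ i : Fin n, δ i ≤ ν i.succ) :
    (∀ T : AltTamari ν δ, ∃! A : Set (AltTamari ν δ), IsCanonicalJoinRep A T) ∧
    IsSimplicialComplex (canonicalJoinComplex (AltTamari ν δ)) ∧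
    ∃ e : ShapeBox (shapeSeq ν δ) ≃ {T : AltTamari ν δ // JoinIrr T},
      (∀ (b : ShapeBox (shapeSeq ν δ)) (s : ℤ × ℤ),
        IsDescent (e b).1 s ↔ s = upperRight ν δ b) ∧
      IsComplexIso (boxComplex (shapeSeq ν δ)) (canonicalJoinComplex (AltTamari ν δ)) e := by
  have := AltTamari.finite ν δ
  refine ⟨(AltTamari.kappaLabelling hδ).existsUnique_canonicalJoinRep,
    (AltTamari.kappaLabelling hδ).isSimplicialComplex_canonicalJoinComplex,
    (AltTamari.kappaLabelling hδ).equiv, AltTamari.isDescent_boxJoin_iff hδ, fun σ => ?_⟩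
  rw [KappaLabelling.image_equiv_mem_canonicalJoinComplex_iff]
  exact AltTamari.mem_boxComplex_iff hδ
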